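/- Let $d$ and $q$ be nonnegative integers, let $B=\{x\in\mathbb{R}^d : |x|\le 1\}$ be the closed Euclidean unit ball, and let $K\subset\mathbb{R}^d$ be a compact convex set containing the origin. Then the function $$\varepsilon\mapsto \int_{K+\varepsilon B}|s|^{2q}\,ds \qquad (\varepsilon\ge 0)$$ is a polynomial in $\varepsilon$ and all of its coefficients are nonnegative; that is, there is a polynomial $p\in\mathbb{R}[X]$ with nonnegative coefficients such that $\int_{K+\varepsilon B}|s|^{2q}\,ds=p(\varepsilon)$ for all real $\varepsilon\ge 0$. Here $K+\varepsilon B=\{x+\varepsilon b : x\in K,\ b\in B\}$ is the Minkowski sum, $|\cdot|$ is the Euclidean norm and $ds$ is Lebesgue measure on $\mathbb{R}^d$. -/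

import Mathlib

open scoped Pointwise

open MeasureTheory Polynomial Filter Topology
open scoped RealInnerProductSpace

/-! Let `π` be the nearest-point projection onto `K`, so that `K + tB` is the set where `‖x - π x‖ ≤
t`. For `t > 0` the map `x ↦ π x + t • (x - π x)` carries `(K + B) \ K` bijectively onto `(K + tB) \
K`, so a change of variables moves all the dependence on `t` into the integrand. Almost everywhere
`π` has a derivative `A`. It is symmetric, as a Hessian, with spectrum in `[0, 1]`, so the Jacobian
`det (A + t (1 - A))` is a product of factors `a + t (1 - a)`. The squared norm of the image point
is quadratic in `t`, with cross term `2⟪π x, x - π x⟫ ≥ 0` because `0 ∈ K`. The integrand is thus a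
polynomial in `t` with nonnegative coefficients, and integration preserves this. -/

/-- The real polynomials all of whose coefficients are nonnegative. -/
def nonnegCoeff : Subsemiring ℝ[X] where
  carrier := {p | ∀ i, 0 ≤ p.coeff i}
  mul_mem' {p r} hp hr i := by
    rw [coeff_mul]
    exact Finset.sum_nonneg fun x _ => mul_nonneg (hp _) (hr _)
  one_mem' i := by
    rw [coeff_one]
    split_ifs <;> simp
  add_mem' {p r} hp hr i := by
    rw [coeff_add]
    exact add_nonneg (hp i) (hr i)
  zero_mem' i := by simp

theorem C_mem_nonnegCoeff {a : ℝ} (ha : 0 ≤ a) : C a ∈ nonnegCoeff := by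
  intro i
  rw [coeff_C]
  split_ifs <;> simp [ha]

theorem X_mem_nonnegCoeff : (X : ℝ[X]) ∈ nonnegCoeff := by
  intro i
  rw [coeff_X]
  split_ifs <;> simp

theorem eval_nonneg_of_mem_nonnegCoeff {p : ℝ[X]} (hp : p ∈ nonnegCoeff) {t : ℝ} (ht : 0 ≤ t) :
    0 ≤ p.eval t := by
  rw [eval_eq_sum_range]
  exact Finset.sum_nonneg fun i _ => mul_nonneg (hp i) (pow_nonneg ht i)

/-- Integrating a family of polynomials of bounded degree with nonnegative coefficients gives
a polynomial with nonnegative coefficients. -/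
theorem exists_polynomial_integral_eq {α : Type*} [MeasurableSpace α] {μ : Measure α}
    {f : ℝ → α → ℝ} {N : ℕ} (hint : ∀ t, 0 < t → Integrable (f t) μ)
    (hf : ∀ᵐ x ∂μ, ∃ P ∈ nonnegCoeff, P.natDegree ≤ N ∧ ∀ t, 0 ≤ t → f t x = P.eval t) :
    ∃ p ∈ nonnegCoeff, ∀ t, 0 ≤ t → ∫ x, f t x ∂μ = p.eval t := by
  set s := Finset.range (N + 1)
  -- Lagrange interpolation makes each coefficient a fixed linear combination of values of `f`,
  -- hence integrable. The nodes avoid `0`, where integrability is not assumed.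
  set v : ℕ → ℝ := fun j => (j : ℝ) + 1
  have hvpos : ∀ j, 0 < v j := fun j => by positivity
  have hv : Set.InjOn v s := fun a _ b _ hab => by simpa [v] using hab
  have hP : ∀ᵐ x ∂μ, ∃ P ∈ nonnegCoeff,
      P = ∑ j ∈ s, C (f (v j) x) * Lagrange.basis s v j ∧ ∀ t, 0 ≤ t → f t x = P.eval t := by
    filter_upwards [hf] with x ⟨P, hP, hdeg, hev⟩
    refine ⟨P, hP, ?_, hev⟩
    have h := Lagrange.eq_interpolate (f := P) hv (by
      refine lt_of_le_of_lt degree_le_natDegree ?_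
      simp only [s, Finset.card_range]
      exact_mod_cast Nat.lt_succ_of_le hdeg)
    rw [Lagrange.interpolate_apply] at h
    conv_lhs => rw [h]
    exact Finset.sum_congr rfl fun j _ => by rw [hev _ (hvpos j).le]
  refine ⟨∑ j ∈ s, C (∫ x, f (v j) x ∂μ) * Lagrange.basis s v j, fun i => ?_, fun t ht => ?_⟩
  · have : (∑ j ∈ s, C (∫ x, f (v j) x ∂μ) * Lagrange.basis s v j).coeff i
        = ∫ x, ∑ j ∈ s, f (v j) x * (Lagrange.basis s v j).coeff i ∂μ := by
      rw [integral_finsetSum _ fun j _ => (hint _ (hvpos j)).mul_const _]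
      simp [integral_mul_const]
    rw [this]
    refine integral_nonneg_of_ae ?_
    filter_upwards [hP] with x ⟨P, hP, hPe, _⟩
    have := hP i
    rw [hPe] at this
    simpa [finsetSum_coeff] using this
  · have : (∑ j ∈ s, C (∫ x, f (v j) x ∂μ) * Lagrange.basis s v j).eval t
        = ∫ x, ∑ j ∈ s, f (v j) x * (Lagrange.basis s v j).eval t ∂μ := by
      rw [integral_finsetSum _ fun j _ => (hint _ (hvpos j)).mul_const _]
      simp [eval_finsetSum, integral_mul_const]
    rw [this]
    refine integral_congr_ae ?_
    filter_upwards [hP] with x ⟨P, hP, hPe, hev⟩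
    rw [hev t ht, hPe]
    simp [eval_finsetSum]

/-! ### Nearest-point projection and its derivative. -/

section Projection

variable {E : Type*} [NormedAddCommGroup E] [InnerProductSpace ℝ E]

/-- `π` sends every point to its nearest point in the convex set `K`, expressed by the
variational inequality. -/
structure IsMetricProjection (K : Set E) (π : E → E) : Prop where
  mem : ∀ x, π x ∈ K
  inner_le_zero : ∀ x, ∀ y ∈ K, ⟪x - π x, y - π x⟫ ≤ 0

theorem exists_isMetricProjection {K : Set E} (hne : K.Nonempty) (hK : IsComplete K)
    (hconv : Convex ℝ K) : ∃ π, IsMetricProjection K π := by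
  choose π hmem hπ using exists_norm_eq_iInf_of_complete_convex hne hK hconv
  exact ⟨π, hmem, fun x => (norm_eq_iInf_iff_real_inner_le_zero hconv (hmem x)).1 (hπ x)⟩

namespace IsMetricProjection

variable {K : Set E} {π : E → E} (h : IsMetricProjection K π)

include h

theorem norm_sq_le_inner (x y : E) : ‖π x - π y‖ ^ 2 ≤ ⟪π x - π y, x - y⟫ := by
  have h1 := h.inner_le_zero x _ (h.mem y)
  have h2 := h.inner_le_zero y _ (h.mem x)
  rw [← real_inner_self_eq_norm_sq]
  simp only [inner_sub_left, inner_sub_right] at *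
  linarith [real_inner_comm x (π x), real_inner_comm y (π x), real_inner_comm x (π y),
    real_inner_comm y (π y)]

theorem lipschitzWith : LipschitzWith 1 π := by
  refine LipschitzWith.of_dist_le_mul fun x y => ?_
  rw [dist_eq_norm, dist_eq_norm, NNReal.coe_one, one_mul]
  have h1 := h.norm_sq_le_inner x y
  have h2 := real_inner_le_norm (π x - π y) (x - y)
  by_contra! hlt
  nlinarith [norm_nonneg (x - y)]

theorem eq_of_inner_le_zero {x p : E} (hp : p ∈ K) (hx : ∀ y ∈ K, ⟪x - p, y - p⟫ ≤ 0) :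
    π x = p := by
  have h1 := h.inner_le_zero x p hp
  have h2 := hx _ (h.mem x)
  have : ⟪π x - p, π x - p⟫ ≤ 0 := by
    simp only [inner_sub_left, inner_sub_right] at *
    linarith [real_inner_comm (π x) p]
  rw [real_inner_self_eq_norm_sq] at this
  exact sub_eq_zero.1 (norm_eq_zero.1 (pow_eq_zero_iff two_ne_zero |>.1
    (le_antisymm this (sq_nonneg _))))

theorem map_ray (x : E) {t : ℝ} (ht : 0 ≤ t) : π (π x + t • (x - π x)) = π x := by
  refine h.eq_of_inner_le_zero (h.mem x) fun y hy => ?_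
  rw [add_sub_cancel_left, inner_smul_left]
  exact mul_nonpos_of_nonneg_of_nonpos ht (h.inner_le_zero x y hy)

theorem map_of_mem {x : E} (hx : x ∈ K) : π x = x :=
  h.eq_of_inner_le_zero hx fun y _ => by simp

theorem norm_sub_le (x : E) {y : E} (hy : y ∈ K) : ‖x - π x‖ ≤ ‖x - y‖ := by
  have h1 := h.inner_le_zero x y hy
  have h2 : ‖x - y‖ ^ 2 = ‖x - π x‖ ^ 2 - 2 * ⟪x - π x, y - π x⟫ + ‖y - π x‖ ^ 2 := by
    rw [← norm_sub_sq_real]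
    congr 2
    abel
  exact le_of_sq_le_sq (by nlinarith [sq_nonneg ‖y - π x‖]) (norm_nonneg _)

open scoped Pointwise in
theorem add_smul_closedBall {t : ℝ} (ht : 0 ≤ t) :
    K + t • Metric.closedBall (0 : E) 1 = {x | ‖x - π x‖ ≤ t} := by
  ext x
  simp only [Set.mem_add, Set.mem_smul_set, Metric.mem_closedBall, dist_zero_right,
    Set.mem_ofPred_eq]
  constructor
  · rintro ⟨k, hk, _, ⟨b, hb, rfl⟩, rfl⟩
    refine (h.norm_sub_le _ hk).trans ?_
    rw [add_sub_cancel_left, norm_smul, Real.norm_of_nonneg ht]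
    exact mul_le_of_le_one_right ht hb
  · intro hx
    refine ⟨π x, h.mem x, x - π x, ⟨t⁻¹ • (x - π x), ?_, ?_⟩, by abel⟩
    · rw [norm_smul, norm_inv, Real.norm_of_nonneg ht]
      exact inv_mul_le_one_of_le₀ hx ht
    · rcases ht.eq_or_lt with rfl | h0
      · have : x - π x = 0 := norm_le_zero_iff.1 hx
        simp [this]
      · rw [smul_inv_smul₀ h0.ne']

/-- The potential equals `(‖y‖ ^ 2 - ‖y - π y‖ ^ 2) / 2`. Since `π` is its gradient, any derivative
of `π` is a Hessian. -/
theorem hasFDerivAt_potential (x : E) :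
    HasFDerivAt (fun y => ⟪y, π y⟫ - ‖π y‖ ^ 2 / 2) (innerSL ℝ (π x)) x := by
  rw [hasFDerivAt_iff_isLittleO]
  have key : (fun y => ⟪y, π y⟫ - ‖π y‖ ^ 2 / 2 - (⟪x, π x⟫ - ‖π x‖ ^ 2 / 2)
      - innerSL ℝ (π x) (y - x)) =O[𝓝 x] fun y => ‖y - x‖ ^ 2 := by
    refine Asymptotics.IsBigO.of_bound 1 (Eventually.of_forall fun y => ?_)
    have h1 := h.inner_le_zero x _ (h.mem y)
    have h2 := h.inner_le_zero y _ (h.mem x)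
    have h3 := real_inner_le_norm (y - x) (π y - π x)
    have h4 : ‖π y - π x‖ ≤ ‖y - x‖ := by
      simpa [dist_eq_norm] using h.lipschitzWith.dist_le_mul y x
    have h5 : ‖π y - π x‖ ^ 2 = ‖π y‖ ^ 2 - 2 * ⟪π y, π x⟫ + ‖π x‖ ^ 2 := norm_sub_sq_real _ _
    have h6 := real_inner_self_eq_norm_sq (π x)
    have h7 := real_inner_self_eq_norm_sq (π y)
    have h8 : ‖y - x‖ * ‖π y - π x‖ ≤ ‖y - x‖ ^ 2 := by
      rw [sq]
      exact mul_le_mul_of_nonneg_left h4 (norm_nonneg _)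
    have h9 := sq_nonneg ‖π y - π x‖
    have h10 := real_inner_comm (π x) (π y)
    have h11 := real_inner_comm x (π x)
    have h12 := real_inner_comm y (π x)
    rw [one_mul, Real.norm_eq_abs, Real.norm_of_nonneg (sq_nonneg _), innerSL_apply_apply]
    simp only [inner_sub_left, inner_sub_right] at *
    rw [abs_le]
    constructor <;> linarith
  refine key.trans_isLittleO ?_
  have h0 : Tendsto (fun y => y - x) (𝓝 x) (𝓝 0) := by
    have : Continuous fun y : E => y - x := by fun_prop
    simpa using this.tendsto x
  have := (Asymptotics.isLittleO_norm_pow_id (E' := E) (one_lt_two)).comp_tendsto h0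
  simpa [Function.comp_def] using this

theorem isSymmetric_fderiv {x : E} {A : E →L[ℝ] E} (hA : HasFDerivAt π A x) :
    (A : E →ₗ[ℝ] E).IsSymmetric := by
  intro v w
  have := second_derivative_symmetric (𝕜 := ℝ) h.hasFDerivAt_potential
    ((innerSL ℝ : E →L[ℝ] E →L[ℝ] ℝ).hasFDerivAt.comp x hA) v w
  change ⟪A v, w⟫ = ⟪A w, v⟫ at this
  rw [ContinuousLinearMap.coe_coe, this, real_inner_comm]

theorem norm_sq_fderiv_le {x : E} {A : E →L[ℝ] E} (hA : HasFDerivAt π A x) (v : E) :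
    ‖A v‖ ^ 2 ≤ ⟪A v, v⟫ := by
  have hl : HasDerivAt (fun t : ℝ => π (x + t • v)) (A v) 0 := by
    have := hA.hasLineDerivAt v
    exact this
  have ht := hl.tendsto_slope
  refine le_of_tendsto_of_tendsto ((ht.norm).pow 2) (ht.inner tendsto_const_nhds) ?_
  filter_upwards [self_mem_nhdsWithin] with t ht0
  have h1 := h.norm_sq_le_inner (x + t • v) x
  have ht0 : t ≠ 0 := ht0
  rw [slope_def_module]
  simp only [sub_zero, zero_smul, add_zero, norm_smul, norm_inv, inner_smul_left]
  rw [add_sub_cancel_left, inner_smul_right] at h1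
  rw [mul_pow, inv_pow, Real.norm_eq_abs, sq_abs]
  calc _ ≤ (t ^ 2)⁻¹ * (t * ⟪π (x + t • v) - π x, v⟫) := by gcongr
    _ = _ := by
      simp
      field_simp

/-- `π` is constant along the ray from `π x` through `x`, on both sides of `x`. -/
theorem fderiv_normal_eq_zero {x : E} {A : E →L[ℝ] E} (hA : HasFDerivAt π A x) :
    A (x - π x) = 0 := by
  have hl : HasDerivAt (fun t : ℝ => π (x + t • (x - π x))) (A (x - π x)) 0 :=
    hA.hasLineDerivAt _
  have hc : HasDerivAt (fun _ : ℝ => π x) 0 0 := hasDerivAt_const _ _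
  refine hl.unique (hc.congr_of_eventuallyEq ?_)
  filter_upwards [lt_mem_nhds (show (-1 : ℝ) < 0 by norm_num)] with t ht
  have := h.map_ray x (t := 1 + t) (by linarith)
  rwa [show π x + (1 + t) • (x - π x) = x + t • (x - π x) by module] at this

end IsMetricProjection

end Projection

/-! ### Jacobian and change of variables. -/

section FiniteDimensional

variable {E : Type*} [NormedAddCommGroup E] [InnerProductSpace ℝ E] [FiniteDimensional ℝ E]

/-- If `A` is symmetric with `A ^ 2 ≤ A`, then `det (A + t (1 - A))` is a polynomial in `t` with
nonnegative coefficients. -/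
theorem exists_polynomial_det_eq {A : E →L[ℝ] E} (hA : (A : E →ₗ[ℝ] E).IsSymmetric)
    (hsq : ∀ v, ‖A v‖ ^ 2 ≤ ⟪A v, v⟫) :
    ∃ P ∈ nonnegCoeff, P.natDegree ≤ Module.finrank ℝ E ∧
      ∀ t : ℝ, (A + t • (ContinuousLinearMap.id ℝ E - A)).det = P.eval t := by
  set ev := hA.eigenvalues rfl
  have hev : ∀ i, 0 ≤ ev i ∧ ev i ≤ 1 := by
    intro i
    have h1 := hsq (hA.eigenvectorBasis rfl i)
    have h2 : A (hA.eigenvectorBasis rfl i) = ev i • hA.eigenvectorBasis rfl i :=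
      hA.apply_eigenvectorBasis rfl i
    rw [h2, inner_smul_left, real_inner_self_eq_norm_sq, norm_smul, OrthonormalBasis.norm_eq_one,
      mul_one, Real.norm_eq_abs, sq_abs] at h1
    simp only [conj_trivial, one_pow, mul_one] at h1
    constructor <;> nlinarith
  refine ⟨∏ i, (C (ev i) + C (1 - ev i) * X), ?_, ?_, fun t => ?_⟩
  · exact prod_mem fun i _ => add_mem (C_mem_nonnegCoeff (hev i).1)
      (mul_mem (C_mem_nonnegCoeff (by linarith [(hev i).2])) X_mem_nonnegCoeff)
  · refine (natDegree_prod_le _ _).trans ?_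
    refine (Finset.sum_le_card_nsmul _ _ 1 fun i _ => ?_).trans (by simp)
    rw [add_comm]
    exact natDegree_linear_le
  · set b := (hA.eigenvectorBasis rfl).toBasis
    have hm : LinearMap.toMatrix b b (A : E →ₗ[ℝ] E) = Matrix.diagonal ev :=
      hA.toMatrix_eigenvectorBasis rfl
    have : LinearMap.toMatrix b b
        ((A + t • (ContinuousLinearMap.id ℝ E - A) : E →L[ℝ] E) : E →ₗ[ℝ] E)
        = Matrix.diagonal fun i => ev i + t * (1 - ev i) := by
      simp only [ContinuousLinearMap.toLinearMap_add, ContinuousLinearMap.toLinearMap_smul,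
        ContinuousLinearMap.toLinearMap_sub, map_add, map_smul, map_sub, hm,
        show ((ContinuousLinearMap.id ℝ E : E →L[ℝ] E) : E →ₗ[ℝ] E) = LinearMap.id from rfl,
        LinearMap.toMatrix_id]
      rw [← Matrix.diagonal_one, Matrix.diagonal_sub, ← Matrix.diagonal_smul, Matrix.diagonal_add]
      rfl
    rw [ContinuousLinearMap.det, ← LinearMap.det_toMatrix b, this, Matrix.det_diagonal, eval_prod]
    simp [mul_comm]

theorem IsMetricProjection.exists_polynomial_integrand_eq {K : Set E} {π : E → E}
    (h : IsMetricProjection K π) (h0 : (0 : E) ∈ K) (q : ℕ)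
    {x : E} {A : E →L[ℝ] E} (hA : HasFDerivAt π A x) :
    ∃ P ∈ nonnegCoeff, P.natDegree ≤ Module.finrank ℝ E + q * 2 ∧ ∀ t : ℝ, 0 ≤ t →
      |(A + t • (ContinuousLinearMap.id ℝ E - A)).det| • ‖π x + t • (x - π x)‖ ^ (2 * q)
        = P.eval t := by
  obtain ⟨P, hP, hdeg, hev⟩ :=
    exists_polynomial_det_eq (h.isSymmetric_fderiv hA) (h.norm_sq_fderiv_le hA)
  have hin : 0 ≤ ⟪π x, x - π x⟫ := by
    have := h.inner_le_zero x 0 h0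
    rw [zero_sub, inner_neg_right, real_inner_comm] at this
    linarith
  refine ⟨P * (C (‖π x‖ ^ 2) + C (2 * ⟪π x, x - π x⟫) * X + C (‖x - π x‖ ^ 2) * X ^ 2) ^ q,
    mul_mem hP (pow_mem (add_mem (add_mem (C_mem_nonnegCoeff (by positivity))
      (mul_mem (C_mem_nonnegCoeff (by positivity)) X_mem_nonnegCoeff))
      (mul_mem (C_mem_nonnegCoeff (by positivity)) (pow_mem X_mem_nonnegCoeff 2))) q), ?_, ?_⟩
  · refine natDegree_mul_le.trans (add_le_add hdeg (natDegree_pow_le_of_le q ?_))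
    compute_degree
  · intro t ht
    rw [hev, abs_of_nonneg (eval_nonneg_of_mem_nonnegCoeff hP ht), eval_mul, smul_eq_mul, pow_mul,
      norm_add_sq_real, inner_smul_right, norm_smul, mul_pow, Real.norm_eq_abs, sq_abs]
    simp only [eval_pow, eval_add, eval_mul, eval_C, eval_X]
    ring

variable [MeasurableSpace E] [BorelSpace E]

/-- Haar measure and Hausdorff measure of full dimension have the same null sets, and Lipschitz maps
preserve Hausdorff null sets. -/
theorem LipschitzWith.addHaar_image_eq_zero {f : E → E} {L : NNReal} (hf : LipschitzWith L f)
    (μ : Measure E) [μ.IsAddHaarMeasure] {s : Set E} (hs : μ s = 0) : μ (f '' s) = 0 := by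
  set ν : Measure E := Measure.hausdorffMeasure (Module.finrank ℝ E)
  have h1 : ν s = 0 := Measure.absolutelyContinuous_isAddHaarMeasure ν μ hs
  have h2 : ν (f '' s) = 0 := by
    refine le_antisymm ((hf.hausdorffMeasure_image_le (Nat.cast_nonneg _) s).trans ?_) bot_le
    rw [h1, mul_zero]
  exact Measure.absolutelyContinuous_isAddHaarMeasure μ ν h2

/-- The integral of `‖s‖ ^ (2 * q)` over the part of the `t`-neighbourhood of `K` outside `K`. -/
theorem IsMetricProjection.exists_polynomial_integral_diff_eq {K : Set E} {π : E → E}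
    (h : IsMetricProjection K π) (h0 : (0 : E) ∈ K)
    (hK : IsCompact K) (μ : Measure E) [μ.IsAddHaarMeasure] (q : ℕ) :
    ∃ p ∈ nonnegCoeff, ∀ t : ℝ, 0 ≤ t →
      ∫ s in {x | ‖x - π x‖ ≤ t} \ K, ‖s‖ ^ (2 * q) ∂μ = p.eval t := by
  have hπc : Continuous π := h.lipschitzWith.continuous
  set S : ℝ → Set E := fun t => {x | ‖x - π x‖ ≤ t} \ K
  have hSm : ∀ t, MeasurableSet (S t) := fun t =>
    (isClosed_le (by fun_prop) continuous_const).measurableSet.diff hK.measurableSet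
  set T : ℝ → E → E := fun t x => π x + t • (x - π x)
  have hT : ∀ t, 0 ≤ t → ∀ x, π (T t x) = π x := fun t ht x => h.map_ray x ht
  have hTsub : ∀ t, 0 ≤ t → ∀ x, T t x - π (T t x) = t • (x - π x) := fun t ht x => by
    rw [hT t ht, add_sub_cancel_left]
  have hTT : ∀ t, 0 < t → ∀ x, T t⁻¹ (T t x) = x := fun t ht x => by
    change π (T t x) + t⁻¹ • (T t x - π (T t x)) = x
    rw [hTsub t ht.le, hT t ht.le, inv_smul_smul₀ ht.ne', add_sub_cancel]
  have hmem : ∀ x, x ∈ K ↔ x - π x = 0 := fun x =>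
    ⟨fun hx => by rw [h.map_of_mem hx, sub_self], fun hx => by
      rw [sub_eq_zero.1 hx]; exact h.mem x⟩
  have hTS : ∀ t, 0 < t → ∀ x, x ∈ S 1 → T t x ∈ S t := fun t ht x hx => by
    refine ⟨?_, fun hk => hx.2 ?_⟩
    · change ‖T t x - π (T t x)‖ ≤ t
      rw [hTsub t ht.le, norm_smul, Real.norm_of_nonneg ht.le]
      exact mul_le_of_le_one_right ht.le hx.1
    · rw [hmem, hTsub t ht.le, smul_eq_zero_iff_right ht.ne'] at hk
      exact (hmem x).2 hk
  have hTS' : ∀ t, 0 < t → ∀ x, x ∈ S t → T t⁻¹ x ∈ S 1 := fun t ht x hx => by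
    have ht' := inv_pos.2 ht
    refine ⟨?_, fun hk => hx.2 ?_⟩
    · change ‖T t⁻¹ x - π (T t⁻¹ x)‖ ≤ 1
      rw [hTsub _ ht'.le, norm_smul, Real.norm_of_nonneg ht'.le]
      exact inv_mul_le_one_of_le₀ hx.1 ht.le
    · rw [hmem, hTsub _ ht'.le, smul_eq_zero_iff_right ht'.ne'] at hk
      exact (hmem x).2 hk
  have himg : ∀ t, 0 < t → T t '' S 1 = S t := fun t ht => by
    refine Set.Subset.antisymm (Set.image_subset_iff.2 (hTS t ht)) fun x hx =>
      ⟨_, hTS' t ht x hx, ?_⟩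
    simpa using hTT t⁻¹ (inv_pos.2 ht) x
  have hTlip : ∀ t, ∃ L, LipschitzWith L (T t) := fun t =>
    ⟨_, h.lipschitzWith.add ((lipschitzWith_smul t).comp (LipschitzWith.id.sub h.lipschitzWith))⟩
  set D : Set E := S 1 ∩ {x | DifferentiableAt ℝ π x}
  have hDm : MeasurableSet D := (hSm 1).inter (measurableSet_of_differentiableAt ℝ π)
  have hDimg : ∀ t, 0 < t → T t '' D =ᵐ[μ] S t := fun t ht => by
    obtain ⟨L, hL⟩ := hTlip t
    rw [← himg t ht]
    refine (ae_eq_set.2 ⟨?_, ?_⟩)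
    -- By Rademacher's theorem only the image of a null set is lost.
    · rw [Set.sdiff_eq_empty.2 (Set.image_mono Set.inter_subset_left), measure_empty]
    · refine measure_mono_null ?_
        (hL.addHaar_image_eq_zero μ (ae_iff.1 (h.lipschitzWith.ae_differentiableAt (μ := μ))))
      rintro _ ⟨⟨x, hx, rfl⟩, hx'⟩
      exact ⟨x, fun hd => hx' ⟨x, ⟨hx, hd⟩, rfl⟩, rfl⟩
  set A : E → E →L[ℝ] E := fderiv ℝ π
  set J : ℝ → E → E →L[ℝ] E := fun t x => A x + t • (ContinuousLinearMap.id ℝ E - A x)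
  have hA : ∀ x ∈ D, HasFDerivAt π (A x) x := fun x hx => hx.2.hasFDerivAt
  have hJ : ∀ t, ∀ x ∈ D, HasFDerivWithinAt (T t) (J t x) D x := fun t x hx =>
    ((hA x hx).add (((hasFDerivAt_id x).sub (hA x hx)).const_smul t)).hasFDerivWithinAt
  have hinj : ∀ t, 0 < t → Set.InjOn (T t) D := fun t ht =>
    (Function.LeftInverse.injective (hTT t ht)).injOn
  set f : ℝ → E → ℝ := fun t x => |(J t x).det| • ‖T t x‖ ^ (2 * q)
  have hbdd : ∀ t, IntegrableOn (fun s : E => ‖s‖ ^ (2 * q)) (S t) μ := fun t => by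
    obtain ⟨R, hR⟩ := hK.isBounded.subset_closedBall (0 : E)
    refine IntegrableOn.mono_set (t := Metric.closedBall 0 (R + t)) ?_ fun x hx => ?_
    · exact (by fun_prop : Continuous fun s : E => ‖s‖ ^ (2 * q)).continuousOn.integrableOn_compact
        (isCompact_closedBall _ _)
    · have h1 : ‖x - π x‖ ≤ t := hx.1
      have h2 : ‖π x‖ ≤ R := by simpa using hR (h.mem x)
      have h3 := norm_add_le (π x) (x - π x)
      rw [add_sub_cancel] at h3
      rw [mem_closedBall_zero_iff]
      linarith
  obtain ⟨p, hp, hpe⟩ := exists_polynomial_integral_eq (μ := μ.restrict D) (f := f)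
    (N := Module.finrank ℝ E + q * 2)
    (fun t ht => (integrableOn_image_iff_integrableOn_abs_det_fderiv_smul μ hDm (hJ t) (hinj t ht)
      (fun s => ‖s‖ ^ (2 * q))).1 ((hbdd t).congr_set_ae (hDimg t ht)))
    ((ae_restrict_mem hDm).mono fun x hx => h.exists_polynomial_integrand_eq h0 q (hA x hx))
  refine ⟨p, hp, fun t ht => ?_⟩
  rw [← hpe t ht]
  rcases ht.eq_or_lt with rfl | ht
  -- At `t = 0` injectivity fails, but both sides vanish: `A` kills the nonzero vector `x - π x`, so
  -- the Jacobian is zero.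
  · have hS0 : S 0 = ∅ := Set.sdiff_eq_empty.2 fun x hx => (hmem x).2 (norm_le_zero_iff.1 hx)
    change ∫ s in S 0, _ ∂μ = _
    rw [hS0, setIntegral_empty]
    refine (setIntegral_eq_zero_of_forall_eq_zero fun x hx => ?_).symm
    have hdet : (J 0 x).det = 0 := by
      by_contra hne
      have hu : IsUnit (LinearMap.det ((J 0 x : E →L[ℝ] E) : E →ₗ[ℝ] E)) := isUnit_iff_ne_zero.2 hne
      refine hx.1.2 ((hmem x).2 ((LinearMap.equivOfIsUnitDet hu).injective ?_))
      simpa [J] using h.fderiv_normal_eq_zero (hA x hx)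
    simp [f, hdet]
  · rw [← integral_image_eq_integral_abs_det_fderiv_smul μ hDm (hJ t) (hinj t ht)
      (fun s => ‖s‖ ^ (2 * q))]
    exact (setIntegral_congr_set (hDimg t ht)).symm

end FiniteDimensional

theorem theorem6p1 (d q : ℕ) (K : Set (EuclideanSpace ℝ (Fin d)))
    (hconv : Convex ℝ K) (hcomp : IsCompact K) (hzero : (0 : EuclideanSpace ℝ (Fin d)) ∈ K) :
    ∃ p : Polynomial ℝ,
      (∀ ε : ℝ, 0 ≤ ε →
        ∫ s in K + ε • Metric.closedBall (0 : EuclideanSpace ℝ (Fin d)) 1,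
          ‖s‖ ^ (2 * q) ∂MeasureTheory.volume = p.eval ε) ∧
      ∀ i : ℕ, 0 ≤ p.coeff i := by
  obtain ⟨π, h⟩ := exists_isMetricProjection ⟨0, hzero⟩ hcomp.isComplete hconv
  obtain ⟨p, hp, hpe⟩ := h.exists_polynomial_integral_diff_eq hzero hcomp volume q
  refine ⟨C (∫ s in K, ‖s‖ ^ (2 * q)) + p, fun ε hε => ?_,
    add_mem (C_mem_nonnegCoeff (integral_nonneg fun s => by positivity)) hp⟩
  have hsub : K ⊆ K + ε • Metric.closedBall (0 : EuclideanSpace ℝ (Fin d)) 1 := by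
    rw [h.add_smul_closedBall hε]
    intro x hx
    simpa [h.map_of_mem hx] using hε
  have hcpt : IsCompact (K + ε • Metric.closedBall (0 : EuclideanSpace ℝ (Fin d)) 1) :=
    hcomp.add ((isCompact_closedBall _ _).smul ε)
  have hint : IntegrableOn (fun s : EuclideanSpace ℝ (Fin d) => ‖s‖ ^ (2 * q))
      (K + ε • Metric.closedBall (0 : EuclideanSpace ℝ (Fin d)) 1) :=
    (by fun_prop : Continuous fun s : EuclideanSpace ℝ (Fin d) =>
      ‖s‖ ^ (2 * q)).continuousOn.integrableOn_compact hcpt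
  rw [eval_add, eval_C, ← hpe ε hε, ← h.add_smul_closedBall hε,
    setIntegral_sdiff hcomp.measurableSet hint hsub]
  ring
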